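/- Let $n\ge 0$. A permutation of the multiset $\{1,1,2,2,\dots,n,n\}$ is a word $\pi=\pi_1\pi_2\cdots\pi_{2n}$ in which each of $1,\dots,n$ occurs exactly twice; it is called nonnesting if there are no indices $i<j<\ell<m$ with $\pi_i=\pi_m$ and $\pi_j=\pi_\ell$. For a word $w=w_1\cdots w_m$, let $\mathrm{des}(w)$ be the number of $i\in\{1,\dots,m-1\}$ with $w_i>w_{i+1}$, and let $\mathrm{plat}(w)$ be the number of $i\in\{1,\dots,m-1\}$ with $w_i=w_{i+1}$. For a permutation $\sigma=\sigma_1\cdots\sigma_n$ of $\{1,\dots,n\}$, let $\mathcal{C}_n^\sigma$ be the set of nonnesting permutations of $\{1,1,\dots,n,n\}$ in which the first copies of the $n$ letters, read from left to right, form the word $\sigma$. Let $\mathcal{D}_n$ be the set of lattice paths from $(0,0)$ to $(n,n)$ with steps $E=(1,0)$ and $N=(0,1)$ that do not go above the diagonal $y=x$. A peak of such a path $D$ is an occurrence of two adjacent steps $EN$; it is low if these steps touch the diagonal, and high otherwise. Let $\mathrm{lpea}(D)$ and $\mathrm{hpea}(D)$ be the numbers of low and of high peaks of $D$, and let $$N_n(t,u)=\sum_{D\in\mathcal{D}_n}t^{\mathrm{hpea}(D)}u^{\mathrm{lpea}(D)}.$$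 Then, for every permutation $\sigma$ of $\{1,\dots,n\}$, the following identity of polynomials in $t$ and $u$ holds: $$\sum_{\pi\in\mathcal{C}_n^\sigma}t^{\mathrm{des}(\pi)}u^{\mathrm{plat}(\pi)}=t^{\mathrm{des}(\sigma)}\,N_n(t,u).$$ -/

import Mathlib

namespace Nonnesting

/-- The number of descents of a word `w₁ w₂ … wₘ`: positions `i` that have a next position and
satisfy `wᵢ > wᵢ₊₁`. The last position is never a descent. -/
def des {α : Type*} [LinearOrder α] {m : ℕ} (w : Fin m → α) : ℕ :=
  (Finset.univ.filter fun i : Fin m => ∃ h : i.val + 1 < m, w ⟨i.val + 1, h⟩ < w i).card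

/-- The number of plateaus of a word: positions `i` that have a next position and
satisfy `wᵢ = wᵢ₊₁`. -/
def plat {α : Type*} [LinearOrder α] {m : ℕ} (w : Fin m → α) : ℕ :=
  (Finset.univ.filter fun i : Fin m => ∃ h : i.val + 1 < m, w i = w ⟨i.val + 1, h⟩).card

/-- A word of length `2n` over the `n` ordered letters `Fin n` (playing the role of `1 < ⋯ < n`)
is a permutation of the multiset `{1,1,2,2,…,n,n}`: every letter occurs exactly twice. -/
def IsMultisetPerm {n : ℕ} (w : Fin (2 * n) → Fin n) : Prop :=
  ∀ a : Fin n, (Finset.univ.filter fun i => w i = a).card = 2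

/-- There are no positions `i < j < l < m` with `wᵢ = wₘ` and `wⱼ = wₗ`. -/
def IsNonnesting {n : ℕ} (w : Fin (2 * n) → Fin n) : Prop :=
  ¬ ∃ i j l m : Fin (2 * n), i < j ∧ j < l ∧ l < m ∧ w i = w m ∧ w j = w l

/-- The subsequence of `w` formed by the first copy of each of its letters, read from left
to right. -/
def firstCopies {n : ℕ} (w : Fin (2 * n) → Fin n) : List (Fin n) :=
  ((List.finRange (2 * n)).filter fun i => ∀ j, j < i → w j ≠ w i).map w

open Classical in
/-- The nonnesting permutations of `{1,1,…,n,n}` whose subsequence of first copies is the one-line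
notation `σ₁ σ₂ … σₙ` of `σ`. -/
noncomputable def nonnestingPerms {n : ℕ} (σ : Equiv.Perm (Fin n)) :
    Finset (Fin (2 * n) → Fin n) :=
  Finset.univ.filter fun w =>
    IsMultisetPerm w ∧ IsNonnesting w ∧ firstCopies w = List.ofFn (fun i => σ i)

/-- The polynomial `∑ t^des(π) u^plat(π)` over the nonnesting permutations `π` with subsequence of
first copies `σ`; the variables are `t = X 0` and `u = X 1`. -/
noncomputable def C {n : ℕ} (σ : Equiv.Perm (Fin n)) : MvPolynomial (Fin 2) ℤ :=
  ∑ w ∈ nonnestingPerms σ, MvPolynomial.X 0 ^ des w * MvPolynomial.X 1 ^ plat w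

/-- Positions `i` of the peaks of a Dyck path: step `i` is `U = E = (1,0)` and the next step is
`D = N = (0,1)`. -/
def peaks (p : DyckWord) : Finset ℕ :=
  (Finset.range p.toList.length).filter fun i =>
    p.toList[i]? = some DyckStep.U ∧ p.toList[i + 1]? = some DyckStep.D

/-- The point of the path reached after `i` steps lies on the diagonal. -/
def OnDiagonal (p : DyckWord) (i : ℕ) : Prop :=
  (p.toList.take i).count DyckStep.U = (p.toList.take i).count DyckStep.D

instance (p : DyckWord) : DecidablePred (OnDiagonal p) :=
  fun _ => inferInstanceAs (Decidable (_ = _))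

/-- The number of low peaks. The peak at position `i` consists of two steps between the three points
reached after `i`, `i + 1` and `i + 2` steps; it is low if one of them is on the diagonal. -/
def lowPeaks (p : DyckWord) : ℕ :=
  ((peaks p).filter fun i => OnDiagonal p i ∨ OnDiagonal p (i + 1) ∨ OnDiagonal p (i + 2)).card

/-- The number of high peaks, i.e. of peaks that do not touch the diagonal. -/
def highPeaks (p : DyckWord) : ℕ :=
  ((peaks p).filter fun i =>
    ¬ (OnDiagonal p i ∨ OnDiagonal p (i + 1) ∨ OnDiagonal p (i + 2))).card

/-- The Narayana polynomial `N_n(t,u) = ∑ t^(high peaks) u^(low peaks)` over all Dyck paths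
from `(0,0)` to `(n,n)`, with `t = X 0` and `u = X 1`. -/
noncomputable def N (n : ℕ) : MvPolynomial (Fin 2) ℤ :=
  ∑ p : {p : DyckWord // p.semilength = n},
    MvPolynomial.X 0 ^ highPeaks p.1 * MvPolynomial.X 1 ^ lowPeaks p.1

end Nonnesting

namespace Nonnesting

/-! Nonnesting forces the second copies to appear in the same order σ as the first. Marking first
copies by up steps and second copies by down steps therefore identifies the words with Dyck paths:
the letter at a step is σ at the index of that step among steps of its kind (`C_eq_sum_ballot`). For
increasing σ, a descent is exactly a high peak and a plateau a low peak (`peak_iff`), so N_n is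
itself such a word sum. It remains to see that σ affects the sum only through the factor t^des(σ).

Build paths step by step, keeping the last letter. Lift the letters of σ to an increasing sequence
by adding one turn of the alphabet at each descent. The partial sums depend on σ only through a
power of t and the number m of full turns between the two current letters. One further letter
changes m by 0 or 1, and `transfer_step` says that the σ-free polynomials `transfer` obey the
matching recursion in both cases. On the diagonal m = 0, so `recursion_solution` leaves only
t^des(σ) times `transfer t u n n 0`, which the identity ordering shows to be N_n. -/

/-- The partial generating polynomials of ballot paths at the point with `a` up steps and `b` down
steps. The parameter `m` counts how often the lifted letters of the last two steps have wound around
the alphabet. -/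
def transfer {R : Type*} [CommRing R] (t u : R) : ℕ → ℕ → ℕ → R
  | _, 0, m => t ^ m
  | 0, _ + 1, 0 => 0
  | a + 1, b + 1, 0 =>
    if a = b then transfer t u (a + 1) b 1 + (u - t) * transfer t u a b 0
    else transfer t u a (b + 1) 0 + transfer t u (a + 1) b 1
  | a, b + 1, m + 1 => t * transfer t u a (b + 1) m + (1 - t) * transfer t u a b (m + 1)
termination_by a b m => (b, m, a)

/-! ### The universal transfer polynomials -/

section Transfer
variable {R : Type*} [CommRing R] (t u : R)

theorem transfer_zero (a m : ℕ) : transfer t u a 0 m = t ^ m := by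
  rw [transfer]

theorem transfer_diag (a : ℕ) : transfer t u (a + 1) (a + 1) 0 =
    transfer t u (a + 1) a 1 + (u - t) * transfer t u a a 0 := by
  rw [transfer, if_pos rfl]

theorem transfer_of_lt {a b : ℕ} (hab : b < a) : transfer t u (a + 1) (b + 1) 0 =
    transfer t u a (b + 1) 0 + transfer t u (a + 1) b 1 := by
  rw [transfer, if_neg (by omega)]

theorem transfer_level (a b m : ℕ) : transfer t u a (b + 1) (m + 1) =
    t * transfer t u a (b + 1) m + (1 - t) * transfer t u a b (m + 1) := by
  rw [transfer]

/-- These are the two possible recursions when a letter is added, according to whether the winding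
changes. Substituting the first into `transfer_level` gives the second; the first holds by
definition at m = 0 and climbs in m using both identities for the preceding b. -/
theorem transfer_step {a b : ℕ} (hab : b < a) (m : ℕ) :
    transfer t u (a + 1) (b + 1) m =
      transfer t u a (b + 1) m + transfer t u (a + 1) b (m + 1) ∧
    transfer t u (a + 1) (b + 1) (m + 1) =
      t * transfer t u a (b + 1) m + transfer t u (a + 1) b (m + 1) := by
  have key : ∀ b m, transfer t u (a + 1) (b + 1) m =
      transfer t u a (b + 1) m + transfer t u (a + 1) b (m + 1) →
      transfer t u (a + 1) (b + 1) (m + 1) =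
      t * transfer t u a (b + 1) m + transfer t u (a + 1) b (m + 1) := by
    intro b m h
    rw [transfer_level, h]; ring
  induction b generalizing m with
  | zero =>
    have h : ∀ m, transfer t u (a + 1) 1 m = transfer t u a 1 m + transfer t u (a + 1) 0 (m + 1) := by
      intro m
      induction m with
      | zero => exact transfer_of_lt t u (by omega)
      | succ m ih =>
        rw [key 0 m ih, transfer_level]
        simp only [transfer_zero]; ring
    exact ⟨h m, key 0 m (h m)⟩
  | succ b ihb =>
    have h : ∀ m, transfer t u (a + 1) (b + 2) m =
        transfer t u a (b + 2) m + transfer t u (a + 1) (b + 1) (m + 1) := by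
      intro m
      induction m with
      | zero => exact transfer_of_lt t u (by omega)
      | succ m ih =>
        have h1 := (ihb (by omega) (m + 1)).1
        have h2 := (ihb (by omega) (m + 1)).2
        rw [key (b + 1) m ih, transfer_level t u a (b + 1) m, h2, h1]; ring
    exact ⟨h m, key (b + 1) m (h m)⟩

theorem transfer_one (a : ℕ) : transfer t u (a + 2) (a + 1) 1 =
    t * transfer t u (a + 1) (a + 1) 0 + transfer t u (a + 2) a 1 :=
  (transfer_step t u (Nat.lt_succ_self a) 0).2

/-! ### Descents and winding numbers of the letter sequence -/

/-- The number of descents `s i > s (i + 1)` with `i < k`. -/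
def desBefore (s : ℕ → ℕ) (k : ℕ) : ℕ :=
  ((Finset.range k).filter fun i => s (i + 1) < s i).card

/-- Indicator of a descent between the letters of indices `i` and `j`. -/
def drop (s : ℕ → ℕ) (i j : ℕ) : ℕ := if s j < s i then 1 else 0

theorem desBefore_zero (s : ℕ → ℕ) : desBefore s 0 = 0 := by simp [desBefore]

theorem desBefore_succ (s : ℕ → ℕ) (k : ℕ) :
    desBefore s (k + 1) = desBefore s k + drop s k (k + 1) := by
  unfold desBefore drop
  rw [Finset.range_add_one, Finset.filter_insert]
  split_ifs <;> simp

theorem drop_add_drop {s : ℕ → ℕ} (hs : s.Injective) {i j : ℕ} (h : i ≠ j) :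
    drop s i j + drop s j i = 1 := by
  have := hs.ne h
  unfold drop
  split_ifs <;> omega

/-- A detour through an intermediate letter costs at most one extra descent. This is why extending
an interval by one index changes its winding by 0 or 1. -/
theorem drop_triangle (s : ℕ → ℕ) (hs : s.Injective) {i j k : ℕ} (hij : i < j) (hjk : j < k) :
    drop s i k ≤ drop s i j + drop s j k ∧ drop s i j + drop s j k ≤ drop s i k + 1 := by
  have := hs.ne hij.ne
  have := hs.ne hjk.ne
  have := hs.ne (hij.trans hjk).ne
  unfold drop
  split_ifs <;> omega

/-- Ensures that the truncated subtractions in `winding` lose nothing. -/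
theorem desBefore_ge (s : ℕ → ℕ) (hs : s.Injective) {i j : ℕ} (hij : i < j) :
    desBefore s i + drop s i j ≤ desBefore s j := by
  induction j, hij using Nat.le_induction with
  | base => rw [desBefore_succ]
  | succ j hj ih =>
    have := (drop_triangle s hs hj (Nat.lt_succ_self j)).1
    rw [desBefore_succ]
    simp only [Nat.succ_eq_add_one] at *
    omega

/-- The winding number between the letters of indices `i < j`. -/
def winding (s : ℕ → ℕ) (i j : ℕ) : ℕ := desBefore s j - desBefore s i - drop s i j

theorem winding_add (s : ℕ → ℕ) (hs : s.Injective) {i j : ℕ} (hij : i < j) :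
    winding s i j + desBefore s i + drop s i j = desBefore s j := by
  have := desBefore_ge s hs hij
  unfold winding; omega

/-! ### Solving the recursion for arbitrary letters -/

/-- Weight of two consecutive letters of indices `i` and `j`. -/
def pairWeight (s : ℕ → ℕ) (i j : ℕ) : R := t ^ drop s i j * if i = j then u else 1

theorem pairWeight_of_ne (s : ℕ → ℕ) {i j : ℕ} (h : i ≠ j) :
    pairWeight t u s i j = t ^ drop s i j := by simp [pairWeight, h]

theorem pairWeight_self (s : ℕ → ℕ) (i : ℕ) : pairWeight t u s i i = u := by
  simp [pairWeight, drop]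

/-- Any solution of the transfer recursion of ballot paths (`E a b` for paths whose last step is the
up step of index `a`, `F a b` for those whose last step is the down step of index `b`) ends with
the same value up to a power of `t`. -/
theorem recursion_solution (s : ℕ → ℕ) (hs : s.Injective) (E F : ℕ → ℕ → R)
    (hE0 : E 0 0 = 1) (hE : ∀ a, E (a + 1) 0 = pairWeight t u s a (a + 1) * E a 0)
    (hvan : ∀ a, E a (a + 1) = 0)
    (hF0 : ∀ a, F (a + 1) 0 = pairWeight t u s a 0 * E a 0)
    (hF : ∀ a b, b + 1 ≤ a → F (a + 1) (b + 1) =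
      pairWeight t u s a (b + 1) * E a (b + 1) + pairWeight t u s b (b + 1) * F (a + 1) b)
    (hEs : ∀ a b, b ≤ a → E (a + 1) (b + 1) =
      pairWeight t u s a (a + 1) * E a (b + 1) + pairWeight t u s b (a + 1) * F (a + 1) b)
    (a : ℕ) : F (a + 1) a = t ^ desBefore s a * transfer t u (a + 1) (a + 1) 0 := by
  have hEz : ∀ a, E a 0 = t ^ desBefore s a := by
    intro a
    induction a with
    | zero => simp [hE0, desBefore_zero]
    | succ a ih => rw [hE, ih, pairWeight_of_ne _ _ _ (by omega), desBefore_succ]; ring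
  -- The closed form for E at a yields the one for F at a + 1; `hmain` then closes the loop by
  -- induction on a.
  have step : ∀ a, (∀ b, b < a → E a (b + 1) =
      t ^ (desBefore s b + drop s b a) * transfer t u a (b + 1) (winding s b a)) →
      (∀ b, b < a → F (a + 1) b =
        t ^ desBefore s b * transfer t u (a + 1) b (winding s b a + 1)) ∧
      F (a + 1) a = t ^ desBefore s a * transfer t u (a + 1) (a + 1) 0 := by
    intro a ih
    have h1 : ∀ b, b < a → F (a + 1) b =
        t ^ desBefore s b * transfer t u (a + 1) b (winding s b a + 1) := by
      intro b
      induction b with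
      | zero =>
        intro hb
        have e1 := winding_add s hs hb
        have e2 := drop_add_drop hs hb.ne
        rw [hF0, hEz, pairWeight_of_ne _ _ _ hb.ne', transfer_zero, desBefore_zero, pow_zero,
          one_mul, ← pow_add]
        rw [desBefore_zero] at e1
        congr 1; omega
      | succ b ihb =>
        intro hb
        have e1 := winding_add s hs hb
        have e2 := winding_add s hs (Nat.lt_of_succ_lt hb)
        have e3 := drop_add_drop hs hb.ne
        have e4 := desBefore_succ s b
        have e5 := drop_triangle s hs (Nat.lt_succ_self b) hb
        simp only [Nat.succ_eq_add_one] at e5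
        rw [hF a b hb.le, ih b (by omega), ihb (by omega), pairWeight_of_ne _ _ _ hb.ne',
          pairWeight_of_ne _ _ _ (by omega : b ≠ b + 1), ← mul_assoc, ← mul_assoc, ← pow_add,
          ← pow_add]
        have tr := transfer_step t u (Nat.lt_of_succ_lt hb) (winding s b a)
        -- Unchanged winding calls for the second rule of `transfer_step`, a drop by one for the
        -- first.
        rcases (by omega : winding s (b + 1) a = winding s b a ∨
          winding s b a = winding s (b + 1) a + 1) with h | h
        · rw [h, tr.2, (by omega : drop s a (b + 1) + (desBefore s b + drop s b a) =
            desBefore s (b + 1) + 1), (by omega : drop s b (b + 1) + desBefore s b =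
            desBefore s (b + 1))]
          ring
        · rw [← h, tr.1, (by omega : drop s a (b + 1) + (desBefore s b + drop s b a) =
            desBefore s (b + 1)), (by omega : drop s b (b + 1) + desBefore s b =
            desBefore s (b + 1))]
          ring
    refine ⟨h1, ?_⟩
    cases a with
    | zero =>
      rw [hF0, pairWeight_self, hE0, transfer_diag, transfer_zero, transfer_zero, desBefore_zero]
      ring
    | succ a =>
      have e1 := winding_add s hs (Nat.lt_succ_self a)
      have e2 := desBefore_succ s a
      simp only [Nat.succ_eq_add_one] at e1
      have e3 : winding s a (a + 1) = 0 := by omega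
      -- The last pair may be a plateau, of weight u. `transfer_one` would give it weight t, and the
      -- term u - t of `transfer_diag` corrects this.
      rw [hF _ _ le_rfl, pairWeight_self, pairWeight_of_ne _ _ _ (by omega), h1 a (by omega),
        ih a (by omega), e3, transfer_diag t u (a + 1), transfer_one, e2]
      ring
  have hmain : ∀ a b, b < a → E a (b + 1) =
      t ^ (desBefore s b + drop s b a) * transfer t u a (b + 1) (winding s b a) := by
    intro a
    induction a with
    | zero => intro b hb; omega
    | succ a ih =>
      intro b hb
      obtain ⟨s1, s2⟩ := step a ih
      have e1 := winding_add s hs hb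
      have e4 := desBefore_succ s a
      rw [hEs a b (by omega), pairWeight_of_ne _ _ _ (by omega),
        pairWeight_of_ne _ _ _ (by omega)]
      rcases (by omega : b < a ∨ b = a) with hba | rfl
      · have e2 := winding_add s hs hba
        have e5 := drop_triangle s hs hba (Nat.lt_succ_self a)
        simp only [Nat.succ_eq_add_one] at e5
        rw [ih b hba, s1 b hba, ← mul_assoc, ← mul_assoc, ← pow_add, ← pow_add]
        have tr := transfer_step t u hba (winding s b a)
        rcases (by omega : winding s b (a + 1) = winding s b a ∨
          winding s b (a + 1) = winding s b a + 1) with h | h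
        · rw [h, tr.1, (by omega : drop s a (a + 1) + (desBefore s b + drop s b a) =
            desBefore s b + drop s b (a + 1)), (by omega : drop s b (a + 1) + desBefore s b =
            desBefore s b + drop s b (a + 1))]
          ring
        · rw [h, tr.2, (by omega : drop s a (a + 1) + (desBefore s b + drop s b a) =
            desBefore s b + drop s b (a + 1) + 1),
            (by omega : drop s b (a + 1) + desBefore s b = desBefore s b + drop s b (a + 1))]
          ring
      -- The path has just returned to the diagonal, so its previous step was down and the E term
      -- vanishes.
      · have e3 : winding s b (b + 1) = 0 := by omega
        rw [hvan, s2, e3]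
        ring
  exact (step a (hmain a)).2

end Transfer

/-! ### Ballot paths and their weights -/

section Paths
open DyckStep

/-- Appending a step to a path, as an embedding. -/
def snoc (x : DyckStep) : List DyckStep ↪ List DyckStep :=
  ⟨fun l => l ++ [x], fun _ _ h => List.append_cancel_right h⟩

theorem snoc_apply (x : DyckStep) (l : List DyckStep) : snoc x l = l ++ [x] := rfl

/-- The paths with `a` up steps and `b` down steps staying weakly below the diagonal. -/
def ballot : ℕ → ℕ → Finset (List DyckStep)
  | 0, 0 => {[]}
  | a + 1, 0 => (ballot a 0).map (snoc U)
  | 0, _ + 1 => ∅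
  | a + 1, b + 1 =>
    if b ≤ a then (ballot a (b + 1)).map (snoc U) ∪ (ballot (a + 1) b).map (snoc D) else ∅

/-- Every prefix of the path has at least as many up steps as down steps. -/
def IsBallot (l : List DyckStep) : Prop := ∀ i, (l.take i).count D ≤ (l.take i).count U

theorem isBallot_append (l : List DyckStep) (x : DyckStep) :
    IsBallot (l ++ [x]) ↔ IsBallot l ∧ (l ++ [x]).count D ≤ (l ++ [x]).count U := by
  constructor
  · intro h
    refine ⟨fun i => ?_, ?_⟩
    · rcases le_total i l.length with hi | hi
      · simpa [List.take_append_of_le_length hi] using h i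
      · rw [List.take_of_length_le hi]
        simpa using h l.length
    · have := h (l ++ [x]).length
      rwa [List.take_length] at this
  · rintro ⟨h, h'⟩ i
    rcases le_or_gt i l.length with hi | hi
    · simpa [List.take_append_of_le_length hi] using h i
    · rwa [List.take_of_length_le (by simpa using hi)]

theorem mem_ballot (l : List DyckStep) (a b : ℕ) :
    l ∈ ballot a b ↔ l.count U = a ∧ l.count D = b ∧ IsBallot l := by
  induction l using List.reverseRecOn generalizing a b with
  | nil =>
    rcases a with _ | a <;> rcases b with _ | b <;> simp [ballot, IsBallot, snoc_apply]
    split_ifs <;> simp [snoc_apply]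
  | append_singleton l x ih =>
    rw [isBallot_append]
    have hb : IsBallot l → l.count D ≤ l.count U := fun h => by simpa using h l.length
    rcases a with _ | a <;> rcases b with _ | b <;> rcases x with _ | _ <;>
      simp [ballot, snoc_apply, ih]
    · intro h1 h2 h3; have := hb h3; omega
    · intro h1 h2; omega
    · split_ifs with h
      · simp [snoc_apply, ih]; grind
      · simp; grind
    · split_ifs with h
      · simp [snoc_apply, ih]; grind
      · simp; grind

/-- The index, among the steps of the same kind, of step `i` of the path. -/
def stepIndex (l : List DyckStep) (i : ℕ) : ℕ := (l.take i).count (l.getD i U)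

theorem stepIndex_append (l : List DyckStep) (x : DyckStep) {i : ℕ} (hi : i < l.length) :
    stepIndex (l ++ [x]) i = stepIndex l i := by
  unfold stepIndex
  rw [List.take_append_of_le_length hi.le, List.getD_append _ _ _ _ hi]

theorem stepIndex_length (l : List DyckStep) (x : DyckStep) :
    stepIndex (l ++ [x]) l.length = l.count x := by
  simp [stepIndex]

variable {R : Type*} [CommRing R] (t u : R) (s : ℕ → ℕ)

/-- The product of the weights of all pairs of consecutive letters of the word of a path. -/
def pathWeight (l : List DyckStep) : R :=
  ∏ i ∈ Finset.range (l.length - 1), pairWeight t u s (stepIndex l i) (stepIndex l (i + 1))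

theorem pathWeight_append (l : List DyckStep) (x y : DyckStep) :
    pathWeight t u s (l ++ [x] ++ [y]) =
      pairWeight t u s (l.count x) ((l ++ [x]).count y) * pathWeight t u s (l ++ [x]) := by
  have h : (l ++ [x] ++ [y]).length - 1 = ((l ++ [x]).length - 1) + 1 := by simp
  rw [pathWeight, h, Finset.prod_range_succ, mul_comm]
  congr 1
  · have h1 : (l ++ [x]).length - 1 = l.length := by simp
    have h2 : (l ++ [x]).length - 1 + 1 = (l ++ [x]).length := by simp
    rw [h2, stepIndex_length, h1, stepIndex_append _ _ (by simp), stepIndex_length]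
  · refine Finset.prod_congr rfl fun i hi => ?_
    simp only [Finset.mem_range] at hi
    rw [stepIndex_append (l ++ [x]) y (by omega), stepIndex_append (l ++ [x]) y (by omega)]

theorem pathWeight_eq (l : List DyckStep) : pathWeight t u s l =
    t ^ ((Finset.range (l.length - 1)).filter fun i =>
      s (stepIndex l (i + 1)) < s (stepIndex l i)).card *
    u ^ ((Finset.range (l.length - 1)).filter fun i =>
      stepIndex l i = stepIndex l (i + 1)).card := by
  unfold pathWeight pairWeight drop
  rw [Finset.prod_mul_distrib, Finset.prod_pow_eq_pow_sum, Finset.card_filter, Finset.prod_ite]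
  simp

theorem sum_ballot_succ {a b : ℕ} (h : b ≤ a) (f : List DyckStep → R) :
    ∑ l ∈ ballot (a + 1) (b + 1), f l =
      ∑ l ∈ ballot a (b + 1), f (l ++ [U]) + ∑ l ∈ ballot (a + 1) b, f (l ++ [D]) := by
  rw [ballot, if_pos h, Finset.sum_union, Finset.sum_map, Finset.sum_map]
  · rfl
  · rw [Finset.disjoint_left]
    intro l h1 h2
    simp only [Finset.mem_map, snoc_apply] at h1 h2
    obtain ⟨l1, -, rfl⟩ := h1
    obtain ⟨l2, -, h2⟩ := h2
    simp at h2

theorem sum_ballot_zero (a : ℕ) (f : List DyckStep → R) :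
    ∑ l ∈ ballot (a + 1) 0, f l = ∑ l ∈ ballot a 0, f (l ++ [U]) := by
  rw [ballot, Finset.sum_map]; rfl

theorem ballot_eq_empty {a b : ℕ} (h : a < b) : ballot a b = ∅ := by
  rw [Finset.eq_empty_iff_forall_notMem]
  intro l hl
  rw [mem_ballot] at hl
  have := hl.2.2 l.length
  rw [List.take_length] at this
  omega

/-- All paths with the same endpoint and the same last two steps end in the same pair of indices, so
the last factor leaves the sum. -/
theorem sum_append_append (a b a' b' : ℕ) (x y : DyckStep) (i j : ℕ)
    (h : ∀ l ∈ ballot a b, l.count x = i ∧ (l ++ [x]).count y = j) (h' : a' = a ∧ b' = b) :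
    ∑ l ∈ ballot a b, pathWeight t u s (l ++ [x] ++ [y]) =
      pairWeight t u s i j * ∑ l ∈ ballot a' b', pathWeight t u s (l ++ [x]) := by
  obtain ⟨rfl, rfl⟩ := h'
  rw [Finset.mul_sum]
  refine Finset.sum_congr rfl fun l hl => ?_
  rw [pathWeight_append, (h l hl).1, (h l hl).2]

/-- The generating polynomial of the words with letters `s` over all Dyck paths. -/
theorem sum_pathWeight (hs : s.Injective) (n : ℕ) :
    ∑ l ∈ ballot n n, pathWeight t u s l =
      t ^ desBefore s (n - 1) * transfer t u n n 0 := by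
  cases n with
  | zero => simp [ballot, pathWeight, transfer_zero, desBefore_zero]
  | succ n =>
    have key := recursion_solution t u s hs
      (fun a b => ∑ l ∈ ballot a b, pathWeight t u s (l ++ [U]))
      (fun a b => ∑ l ∈ ballot a b, pathWeight t u s (l ++ [D]))
      (by simp [ballot, pathWeight])
      (fun a => by
        simp only [sum_ballot_zero]
        refine sum_append_append _ _ _ _ _ _ _ _ _ _ _ (fun l hl => ?_) ⟨rfl, rfl⟩
        rw [mem_ballot] at hl
        simp [hl.1])
      (fun a => by simp [ballot_eq_empty])
      (fun a => by
        simp only [sum_ballot_zero]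
        refine sum_append_append _ _ _ _ _ _ _ _ _ _ _ (fun l hl => ?_) ⟨rfl, rfl⟩
        rw [mem_ballot] at hl
        simp [hl.1, hl.2.1])
      (fun a b h => by
        simp only [sum_ballot_succ (Nat.le_of_succ_le h)]
        congr 1 <;>
        · refine sum_append_append _ _ _ _ _ _ _ _ _ _ _ (fun l hl => ?_) ⟨rfl, rfl⟩
          rw [mem_ballot] at hl
          simp [hl.1, hl.2.1])
      (fun a b h => by
        simp only [sum_ballot_succ h]
        congr 1 <;>
        · refine sum_append_append _ _ _ _ _ _ _ _ _ _ _ (fun l hl => ?_) ⟨rfl, rfl⟩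
          rw [mem_ballot] at hl
          simp [hl.1, hl.2.1])
      n
    rw [sum_ballot_succ le_rfl, ballot_eq_empty (Nat.lt_succ_self n), Finset.sum_empty, zero_add]
    exact key

end Paths

/-! ### The Narayana polynomial as the case of increasing letters -/

section Dyck
open DyckStep

theorem stepIndex_of_getElem? {l : List DyckStep} {i : ℕ} {x : DyckStep} (h : l[i]? = some x) :
    stepIndex l i = (l.take i).count x := by
  simp [stepIndex, List.getD, h]

theorem count_take_succ {l : List DyckStep} {i : ℕ} {x : DyckStep} (h : l[i]? = some x)
    (y : DyckStep) : (l.take (i + 1)).count y = (l.take i).count y + if x = y then 1 else 0 := by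
  rw [List.take_add_one, h, List.count_append]
  simp [List.count_singleton]

/-- With increasing letters, the steps UU, DD and DU are ascents. At UD the down index is at most
the up index, with equality exactly when the peak starts and ends on the diagonal. -/
theorem peak_iff (p : DyckWord) {i : ℕ} (hi : i + 1 < p.toList.length) :
    (stepIndex p.toList (i + 1) < stepIndex p.toList i ↔
      (p.toList[i]? = some U ∧ p.toList[i + 1]? = some D) ∧
        ¬(OnDiagonal p i ∨ OnDiagonal p (i + 1) ∨ OnDiagonal p (i + 2))) ∧
    (stepIndex p.toList i = stepIndex p.toList (i + 1) ↔
      (p.toList[i]? = some U ∧ p.toList[i + 1]? = some D) ∧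
        (OnDiagonal p i ∨ OnDiagonal p (i + 1) ∨ OnDiagonal p (i + 2))) := by
  obtain ⟨x, hx⟩ : ∃ x, p.toList[i]? = some x := ⟨_, List.getElem?_eq_getElem (by omega)⟩
  obtain ⟨y, hy⟩ : ∃ y, p.toList[i + 1]? = some y := ⟨_, List.getElem?_eq_getElem hi⟩
  have b0 := p.count_D_le_count_U i
  have b1 := p.count_D_le_count_U (i + 1)
  have b2 := p.count_D_le_count_U (i + 2)
  have c1 := count_take_succ hx
  have c2 := count_take_succ hy
  rw [stepIndex_of_getElem? hx, stepIndex_of_getElem? hy]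
  unfold OnDiagonal
  have d1 := c1 U
  have d2 := c1 D
  have d3 : (p.toList.take (i + 2)).count U = _ := c2 U
  have d4 : (p.toList.take (i + 2)).count D = _ := c2 D
  rw [hx, hy]
  rcases x with _ | _ <;> rcases y with _ | _ <;> simp at d1 d2 d3 d4 ⊢ <;> omega

theorem highPeaks_eq (p : DyckWord) : highPeaks p =
    ((Finset.range (p.toList.length - 1)).filter fun i =>
      stepIndex p.toList (i + 1) < stepIndex p.toList i).card := by
  unfold highPeaks peaks
  rw [Finset.filter_filter]
  congr 1
  ext i
  simp only [Finset.mem_filter, Finset.mem_range]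
  constructor
  · rintro ⟨h1, h2⟩
    have h3 : i + 1 < p.toList.length := (List.getElem?_eq_some_iff.1 h2.1.2).1
    exact ⟨by omega, (peak_iff p h3).1.2 h2⟩
  · rintro ⟨h1, h2⟩
    exact ⟨by omega, (peak_iff p (by omega)).1.1 h2⟩

theorem lowPeaks_eq (p : DyckWord) : lowPeaks p =
    ((Finset.range (p.toList.length - 1)).filter fun i =>
      stepIndex p.toList i = stepIndex p.toList (i + 1)).card := by
  unfold lowPeaks peaks
  rw [Finset.filter_filter]
  congr 1
  ext i
  simp only [Finset.mem_filter, Finset.mem_range]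
  constructor
  · rintro ⟨h1, h2⟩
    have h3 : i + 1 < p.toList.length := (List.getElem?_eq_some_iff.1 h2.1.2).1
    exact ⟨by omega, (peak_iff p h3).2.2 h2⟩
  · rintro ⟨h1, h2⟩
    exact ⟨by omega, (peak_iff p (by omega)).2.1 h2⟩

theorem N_eq_sum_ballot (n : ℕ) :
    N n = ∑ l ∈ ballot n n, pathWeight (MvPolynomial.X 0) (MvPolynomial.X 1) id l := by
  unfold N
  refine Finset.sum_bij (fun p _ => p.1.toList) ?_ ?_ ?_ ?_
  · rintro ⟨p, hp⟩ -
    rw [mem_ballot]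
    exact ⟨hp, by rw [← p.count_U_eq_count_D]; exact hp, p.count_D_le_count_U⟩
  · rintro ⟨p, hp⟩ - ⟨q, hq⟩ - h
    exact Subtype.ext (DyckWord.ext h)
  · intro l hl
    rw [mem_ballot] at hl
    exact ⟨⟨⟨l, hl.1.trans hl.2.1.symm, hl.2.2⟩, hl.1⟩, Finset.mem_univ _, rfl⟩
  · rintro ⟨p, hp⟩ -
    rw [pathWeight_eq, highPeaks_eq, lowPeaks_eq]
    rfl

theorem N_eq_transfer (n : ℕ) :
    N n = transfer (MvPolynomial.X 0) (MvPolynomial.X 1) n n 0 := by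
  rw [N_eq_sum_ballot, sum_pathWeight _ _ _ Function.injective_id]
  simp [desBefore]

end Dyck

/-! ### Nonnesting permutations as Dyck paths -/

section Words
open DyckStep

/-- `f` and `g` list from left to right the positions of the first and of the second copies. -/
structure CopyPositions {n : ℕ} (σ : Equiv.Perm (Fin n)) (w : Fin (2 * n) → Fin n)
    (f g : Fin n → Fin (2 * n)) : Prop where
  mono_first : StrictMono f
  mono_second : StrictMono g
  lt (k) : f k < g k
  first (k) : w (f k) = σ k
  second (k) : w (g k) = σ k

variable {n : ℕ} {σ : Equiv.Perm (Fin n)} {w : Fin (2 * n) → Fin n} {f g : Fin n → Fin (2 * n)}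

theorem exists_copyPositions (hw : w ∈ nonnestingPerms σ) : ∃ f g, CopyPositions σ w f g := by
  classical
  simp only [nonnestingPerms, Finset.mem_filter, Finset.mem_univ, true_and] at hw
  obtain ⟨h1, h2, h3⟩ := hw
  unfold firstCopies at h3
  set L := (List.finRange (2 * n)).filter fun i => ∀ j, j < i → w j ≠ w i with hL
  have hlen : L.length = n := by simpa using congrArg List.length h3
  have hsort : L.Pairwise (· < ·) := List.Pairwise.filter _ (List.pairwise_lt_finRange _)
  let f : Fin n → Fin (2 * n) := fun k => L[k.val]'(by omega)
  have hf : StrictMono f := fun i j hij => List.pairwise_iff_getElem.1 hsort _ _ _ _ hij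
  have hwf : ∀ k, w (f k) = σ k := by
    intro k
    have : (L.map w)[k.val]? = (List.ofFn fun i => σ i)[k.val]? := by rw [h3]
    rw [List.getElem?_eq_getElem (by simp [hlen]), List.getElem?_eq_getElem (by simp)] at this
    simpa using this
  have hfirst : ∀ k j, j < f k → w j ≠ w (f k) := by
    intro k
    have : f k ∈ L := List.getElem_mem _
    rw [hL, List.mem_filter] at this
    simpa using this.2
  have hg : ∀ k, ∃ j, f k < j ∧ w j = σ k := by
    intro k
    have hmem : f k ∈ Finset.univ.filter fun i => w i = σ k := by simp [hwf]
    obtain ⟨j, hj, hne⟩ := Finset.exists_mem_ne (by rw [h1 (σ k)]; norm_num) (f k)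
    simp only [Finset.mem_filter, Finset.mem_univ, true_and] at hj
    refine ⟨j, lt_of_le_of_ne (not_lt.1 fun h => hfirst k j h ?_) hne.symm, hj⟩
    rw [hj, hwf]
  choose g hfg hwg using hg
  refine ⟨f, g, hf, fun k k' hk => ?_, hfg, hwf, hwg⟩
  -- Second copies out of order would nest the pair of k' inside the pair of k.
  by_contra hle
  have hne : g k ≠ g k' := fun h => hk.ne (σ.injective (by rw [← hwg, ← hwg, h]))
  exact h2 ⟨f k, f k', g k', g k, hf hk, hfg k', lt_of_le_of_ne (not_lt.1 hle) hne.symm,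
    by rw [hwf, hwg], by rw [hwf, hwg]⟩

namespace CopyPositions

theorem first_ne_second (h : CopyPositions σ w f g) (k k' : Fin n) : f k ≠ g k' := by
  intro e
  have : k = k' := σ.injective (by rw [← h.first, ← h.second, e])
  subst this
  exact (h.lt k).ne e

theorem cases (h : CopyPositions σ w f g) (i : Fin (2 * n)) :
    (∃ k, f k = i) ∨ ∃ k, g k = i := by
  have hinj : Function.Injective (Sum.elim f g) :=
    h.mono_first.injective.sumElim h.mono_second.injective h.first_ne_second
  have hbij := (Fintype.bijective_iff_injective_and_card (Sum.elim f g)).2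
    ⟨hinj, by simp [two_mul]⟩
  obtain ⟨k | k, hk⟩ := hbij.2 i
  · exact Or.inl ⟨k, hk⟩
  · exact Or.inr ⟨k, hk⟩

theorem eq_iff (h : CopyPositions σ w f g) (i : Fin (2 * n)) (k : Fin n) :
    w i = σ k ↔ i = f k ∨ i = g k := by
  constructor
  · intro e
    rcases h.cases i with ⟨k', rfl⟩ | ⟨k', rfl⟩
    · rw [h.first] at e
      exact Or.inl (by rw [σ.injective e])
    · rw [h.second] at e
      exact Or.inr (by rw [σ.injective e])
  · rintro (rfl | rfl)
    · exact h.first k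
    · exact h.second k

theorem isFirst_iff (h : CopyPositions σ w f g) (i : Fin (2 * n)) :
    (∀ j, j < i → w j ≠ w i) ↔ ∃ k, f k = i := by
  constructor
  · intro hi
    rcases h.cases i with hk | ⟨k, rfl⟩
    · exact hk
    · exact absurd (by rw [h.first, h.second]) (hi (f k) (h.lt k))
  · rintro ⟨k, rfl⟩ j hj e
    rw [h.first, h.eq_iff] at e
    rcases e with rfl | rfl
    · exact lt_irrefl _ hj
    · exact lt_asymm hj (h.lt k)

theorem mem_nonnestingPerms (h : CopyPositions σ w f g) : w ∈ nonnestingPerms σ := by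
  classical
  simp only [nonnestingPerms, Finset.mem_filter, Finset.mem_univ, true_and]
  refine ⟨fun a => ?_, ?_, ?_⟩
  · obtain ⟨k, rfl⟩ := σ.surjective a
    have : (Finset.univ.filter fun i => w i = σ k) = {f k, g k} := by
      ext i; simp [h.eq_iff]
    rw [this, Finset.card_pair (h.lt k).ne]
  · rintro ⟨i, j, l, m, hij, hjl, hlm, e1, e2⟩
    obtain ⟨k, hk⟩ := σ.surjective (w i)
    obtain ⟨k', hk'⟩ := σ.surjective (w j)
    have a1 := (h.eq_iff i k).1 hk.symm
    have a2 := (h.eq_iff m k).1 (e1.symm.trans hk.symm)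
    have a3 := (h.eq_iff j k').1 hk'.symm
    have a4 := (h.eq_iff l k').1 (e2.symm.trans hk'.symm)
    have l1 := h.lt k
    have l2 := h.lt k'
    have b1 : i = f k ∧ m = g k := by
      have := hij.trans (hjl.trans hlm)
      rcases a1 with rfl | rfl <;> rcases a2 with rfl | rfl
      · exact absurd this (lt_irrefl _)
      · exact ⟨rfl, rfl⟩
      · exact absurd this l1.asymm
      · exact absurd this (lt_irrefl _)
    have b2 : j = f k' ∧ l = g k' := by
      rcases a3 with rfl | rfl <;> rcases a4 with rfl | rfl
      · exact absurd hjl (lt_irrefl _)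
      · exact ⟨rfl, rfl⟩
      · exact absurd hjl l2.asymm
      · exact absurd hjl (lt_irrefl _)
    obtain ⟨rfl, rfl⟩ := b1
    obtain ⟨rfl, rfl⟩ := b2
    exact lt_asymm hlm (h.mono_second (h.mono_first.lt_iff_lt.1 hij))
  · have hL : ((List.finRange (2 * n)).filter fun i => ∀ j, j < i → w j ≠ w i) = List.ofFn f := by
      have s1 : ((List.finRange (2 * n)).filter fun i => ∀ j, j < i → w j ≠ w i).Pairwise
        (· < ·) := List.Pairwise.filter _ (List.pairwise_lt_finRange _)
      have s2 : (List.ofFn f).Pairwise (· < ·) := List.pairwise_ofFn.2 fun i j hij => h.mono_first hij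
      refine List.Perm.eq_of_pairwise' s1 s2 ?_
      refine (List.perm_ext_iff_of_nodup (s1.imp fun h => h.ne) (s2.imp fun h => h.ne)).2
        fun i => ?_
      rw [List.mem_filter, List.mem_ofFn]
      simpa using h.isFirst_iff i
    unfold firstCopies
    rw [hL, List.map_ofFn]
    congr 1
    funext k
    exact h.first k

end CopyPositions

/-- Turns step indices into ranks: with `card_filter_lt_apply`, the position `f k` of an increasing
enumeration has step index k. -/
theorem count_take_eq_card {l : List DyckStep} {m : ℕ} (hl : l.length = m) (x : DyckStep)
    {f : Fin n → Fin m} (hf : f.Injective) (hfx : ∀ i : Fin m, l[i.val]? = some x ↔ ∃ k, f k = i)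
    (i : ℕ) : (l.take i).count x = (Finset.univ.filter fun k => (f k).val < i).card := by
  induction i with
  | zero => simp
  | succ i ih =>
    rcases lt_or_ge i m with hi | hi
    · obtain ⟨y, hy⟩ : ∃ y, l[i]? = some y := ⟨_, List.getElem?_eq_getElem (by omega)⟩
      rw [count_take_succ hy, ih]
      have := hfx ⟨i, hi⟩
      simp only [hy, Option.some.injEq] at this
      split_ifs with h
      · obtain ⟨k, hk⟩ := this.1 h
        rw [← Finset.card_insert_of_notMem (a := k) (by simp [hk])]
        congr 1
        ext k'
        simp only [Finset.mem_insert, Finset.mem_filter, Finset.mem_univ, true_and]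
        constructor
        · rintro (rfl | h)
          · simp [hk]
          · omega
        · intro h'
          rcases (by omega : (f k').val < i ∨ (f k').val = i) with h1 | h1
          · exact Or.inr h1
          · exact Or.inl (hf (Fin.ext (by rw [h1, hk])))
      · rw [add_zero]
        congr 1
        ext k'
        simp only [Finset.mem_filter, Finset.mem_univ, true_and]
        have : (f k').val ≠ i := fun e => h (this.2 ⟨k', Fin.ext e⟩)
        omega
    · rw [List.take_of_length_le (by omega)]
      rw [List.take_of_length_le (by omega)] at ih
      rw [ih]
      congr 1
      ext k'
      simp only [Finset.mem_filter, Finset.mem_univ, true_and]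
      have := (f k').isLt
      omega

theorem card_filter_lt_apply {m : ℕ} {f : Fin n → Fin m} (hf : StrictMono f) (k : Fin n) :
    (Finset.univ.filter fun k' => (f k').val < (f k).val).card = k := by
  have : (Finset.univ.filter fun k' => (f k').val < (f k).val) = Finset.Iio k := by
    ext k'
    simp only [Finset.mem_filter, Finset.mem_univ, true_and, Finset.mem_Iio]
    exact hf.lt_iff_lt
  rw [this, Fin.card_Iio]

open Classical in
/-- The path with an up step at each first copy and a down step at each second copy. -/
noncomputable def stepsOf (w : Fin (2 * n) → Fin n) : List DyckStep :=
  List.ofFn fun i => if ∀ j, j < i → w j ≠ w i then U else D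

theorem stepsOf_length (w : Fin (2 * n) → Fin n) : (stepsOf w).length = 2 * n := by
  simp [stepsOf]

namespace CopyPositions

theorem getElem?_eq_U (h : CopyPositions σ w f g) (i : Fin (2 * n)) :
    (stepsOf w)[i.val]? = some U ↔ ∃ k, f k = i := by
  rw [← h.isFirst_iff]
  simp [stepsOf]

theorem getElem?_eq_D (h : CopyPositions σ w f g) (i : Fin (2 * n)) :
    (stepsOf w)[i.val]? = some D ↔ ∃ k, g k = i := by
  have h1 : (stepsOf w)[i.val]? = some D ↔ ¬ ∃ k, f k = i := by
    rw [← h.isFirst_iff]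
    simp [stepsOf]
  rw [h1]
  constructor
  · exact (h.cases i).resolve_left
  · rintro ⟨k, rfl⟩ ⟨k', hk'⟩
    exact h.first_ne_second _ _ hk'

theorem stepsOf_mem_ballot (h : CopyPositions σ w f g) : stepsOf w ∈ ballot n n := by
  have cU := count_take_eq_card (stepsOf_length w) U h.mono_first.injective h.getElem?_eq_U
  have cD := count_take_eq_card (stepsOf_length w) D h.mono_second.injective h.getElem?_eq_D
  have hlen : (stepsOf w).take (2 * n) = stepsOf w :=
    List.take_of_length_le (stepsOf_length w).le
  rw [mem_ballot]
  refine ⟨?_, ?_, fun i => ?_⟩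
  · rw [← hlen, cU]; simp
  · rw [← hlen, cD]; simp
  · rw [cU, cD]
    refine Finset.card_le_card fun k hk => ?_
    simp only [Finset.mem_filter, Finset.mem_univ, true_and] at hk ⊢
    have := h.lt k
    omega

theorem apply_eq (h : CopyPositions σ w f g) (i : Fin (2 * n)) :
    ∃ hi : stepIndex (stepsOf w) i < n, w i = σ ⟨stepIndex (stepsOf w) i, hi⟩ := by
  have cU := count_take_eq_card (stepsOf_length w) U h.mono_first.injective h.getElem?_eq_U
  have cD := count_take_eq_card (stepsOf_length w) D h.mono_second.injective h.getElem?_eq_D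
  rcases h.cases i with ⟨k, rfl⟩ | ⟨k, rfl⟩
  · have : stepIndex (stepsOf w) (f k) = k := by
      rw [stepIndex_of_getElem? ((h.getElem?_eq_U _).2 ⟨k, rfl⟩), cU,
        card_filter_lt_apply h.mono_first]
    exact ⟨by omega, by simp [this, h.first]⟩
  · have : stepIndex (stepsOf w) (g k) = k := by
      rw [stepIndex_of_getElem? ((h.getElem?_eq_D _).2 ⟨k, rfl⟩), cD,
        card_filter_lt_apply h.mono_second]
    exact ⟨by omega, by simp [this, h.second]⟩

end CopyPositions

theorem length_eq_count_add_count (l : List DyckStep) : l.length = l.count U + l.count D := by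
  induction l with
  | nil => rfl
  | cons x l ih => cases x <;> simp [ih] <;> omega

theorem exists_strictMono_positions {l : List DyckStep} {m : ℕ} (hl : l.length = m)
    (x : DyckStep) (hx : l.count x = n) :
    ∃ f : Fin n → Fin m, StrictMono f ∧ ∀ i : Fin m, l[i.val]? = some x ↔ ∃ k, f k = i := by
  have hcard : (Finset.univ.filter fun i : Fin m => l[i.val]? = some x).card = n := by
    rw [← hx]
    set P := Finset.univ.filter fun i : Fin m => l[i.val]? = some x
    have := count_take_eq_card hl x (P.orderEmbOfFin rfl).injective
      (fun i => by
        have : i ∈ Set.range (P.orderEmbOfFin rfl) ↔ i ∈ P := by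
          rw [Finset.range_orderEmbOfFin]; rfl
        rw [Set.mem_range] at this
        rw [this]
        simp [P]) m
    rw [List.take_of_length_le hl.le] at this
    rw [this]
    simp
  refine ⟨_, (Finset.orderEmbOfFin _ hcard).strictMono, fun i => ?_⟩
  have := Finset.range_orderEmbOfFin _ hcard
  rw [← Set.mem_range, this]
  simp

theorem exists_word (σ : Equiv.Perm (Fin n)) {l : List DyckStep} (hl : l ∈ ballot n n) :
    ∃ w ∈ nonnestingPerms σ, stepsOf w = l := by
  rw [mem_ballot] at hl
  obtain ⟨hU, hD, hb⟩ := hl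
  have hlen : l.length = 2 * n := by rw [length_eq_count_add_count, hU, hD, two_mul]
  obtain ⟨f, hf, hfU⟩ := exists_strictMono_positions hlen U hU
  obtain ⟨g, hg, hgD⟩ := exists_strictMono_positions hlen D hD
  have cU := count_take_eq_card hlen U hf.injective hfU
  have cD := count_take_eq_card hlen D hg.injective hgD
  have hif : ∀ k, stepIndex l (f k) = k := fun k => by
    rw [stepIndex_of_getElem? ((hfU _).2 ⟨k, rfl⟩), cU, card_filter_lt_apply hf]
  have ig : ∀ k, stepIndex l (g k) = k := fun k => by
    rw [stepIndex_of_getElem? ((hgD _).2 ⟨k, rfl⟩), cD, card_filter_lt_apply hg]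
  have hne : ∀ k k', f k ≠ g k' := fun k k' e => by
    have h1 := (hfU (f k)).2 ⟨k, rfl⟩
    have h2 := (hgD (f k)).2 ⟨k', e.symm⟩
    rw [h1] at h2
    simp at h2
  have hlt : ∀ k, f k < g k := by
    intro k
    refine lt_of_le_of_ne (not_lt.1 fun hk => ?_) (hne k k)
    -- If the down step k preceded the up step k, the prefix before `f k` would hold k up steps but
    -- at least k + 1 down steps.
    have h1 := hb (f k)
    rw [cU, cD, card_filter_lt_apply hf] at h1
    have h2 : Finset.Iic k ⊆ Finset.univ.filter fun k' => (g k').val < (f k).val := by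
      intro k' hk'
      simp only [Finset.mem_filter, Finset.mem_univ, true_and]
      exact lt_of_le_of_lt (hg.monotone (Finset.mem_Iic.1 hk')) hk
    have h3 := Finset.card_le_card h2
    rw [Fin.card_Iic] at h3
    omega
  have hidx : ∀ i : Fin (2 * n), stepIndex l i < n := by
    intro i
    obtain ⟨y, hy⟩ : ∃ y, l[i.val]? = some y := ⟨_, List.getElem?_eq_getElem (by omega)⟩
    cases y with
    | U => obtain ⟨k, rfl⟩ := (hfU i).1 hy; rw [hif]; exact k.isLt
    | D => obtain ⟨k, rfl⟩ := (hgD i).1 hy; rw [ig]; exact k.isLt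
  have hw : CopyPositions σ (fun i => σ ⟨stepIndex l i, hidx i⟩) f g :=
    ⟨hf, hg, hlt, fun k => by simp [hif], fun k => by simp [ig]⟩
  refine ⟨_, hw.mem_nonnestingPerms, ?_⟩
  refine List.ext_getElem? fun i => ?_
  rcases lt_or_ge i (2 * n) with hi | hi
  · obtain ⟨y, hy⟩ : ∃ y, l[i]? = some y := ⟨_, List.getElem?_eq_getElem (by omega)⟩
    rw [hy]
    cases y with
    | U => exact (hw.getElem?_eq_U ⟨i, hi⟩).2 ((hfU ⟨i, hi⟩).1 hy)
    | D => exact (hw.getElem?_eq_D ⟨i, hi⟩).2 ((hgD ⟨i, hi⟩).1 hy)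
  · rw [List.getElem?_eq_none (by rwa [stepsOf_length]), List.getElem?_eq_none (by omega)]

/-- The letters of `σ` as natural numbers, continued injectively to all indices. -/
def letters (σ : Equiv.Perm (Fin n)) (k : ℕ) : ℕ := if h : k < n then (σ ⟨k, h⟩).val else k

theorem letters_of_lt (σ : Equiv.Perm (Fin n)) {k : ℕ} (h : k < n) :
    letters σ k = (σ ⟨k, h⟩).val := by simp [letters, h]

theorem letters_injective (σ : Equiv.Perm (Fin n)) : (letters σ).Injective := by
  intro i j h
  unfold letters at h
  split_ifs at h with h1 h2 h2
  · simpa using σ.injective (Fin.ext h)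
  · have := (σ ⟨i, h1⟩).isLt; omega
  · have := (σ ⟨j, h2⟩).isLt; omega
  · exact h

theorem card_filter_fin_eq {m : ℕ} (P : ℕ → Prop) [DecidablePred P] (Q : Fin m → Prop)
    [DecidablePred Q] (h : ∀ i : Fin m, Q i ↔ i.val + 1 < m ∧ P i) :
    (Finset.univ.filter Q).card = ((Finset.range (m - 1)).filter P).card := by
  refine Finset.card_bij (fun i _ => i.val) ?_ (fun i _ j _ e => Fin.ext e) ?_
  · intro i hi
    simp only [Finset.mem_filter, Finset.mem_univ, true_and, Finset.mem_range, h] at hi ⊢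
    exact ⟨by omega, hi.2⟩
  · intro i hi
    simp only [Finset.mem_filter, Finset.mem_range] at hi
    exact ⟨⟨i, by omega⟩, by simp [h, hi.2]; omega, rfl⟩

theorem des_perm (σ : Equiv.Perm (Fin n)) :
    des (fun i => σ i) = desBefore (letters σ) (n - 1) := by
  unfold des desBefore
  refine card_filter_fin_eq _ _ fun i => ?_
  rw [← exists_prop]
  refine exists_congr fun h => ?_
  rw [letters_of_lt σ h, letters_of_lt σ i.isLt]
  rfl

theorem weight_eq_pathWeight {R : Type*} [CommRing R] (t u : R) (hw : w ∈ nonnestingPerms σ) :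
    t ^ des w * u ^ plat w = pathWeight t u (letters σ) (stepsOf w) := by
  obtain ⟨f, g, h⟩ := exists_copyPositions hw
  have key : ∀ i : Fin (2 * n), (w i).val = letters σ (stepIndex (stepsOf w) i) := by
    intro i
    obtain ⟨hi, e⟩ := h.apply_eq i
    rw [letters_of_lt σ hi, e]
  rw [pathWeight_eq, stepsOf_length]
  congr 2
  · refine card_filter_fin_eq _ _ fun i => ?_
    rw [← exists_prop]
    refine exists_congr fun h => ?_
    rw [Fin.lt_def, key, key]
  · refine card_filter_fin_eq _ _ fun i => ?_
    rw [← exists_prop]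
    refine exists_congr fun h => ?_
    rw [Fin.ext_iff, key, key, (letters_injective σ).eq_iff]

theorem C_eq_sum_ballot (σ : Equiv.Perm (Fin n)) :
    C σ = ∑ l ∈ ballot n n,
      pathWeight (MvPolynomial.X 0) (MvPolynomial.X 1) (letters σ) l := by
  unfold C
  refine Finset.sum_bij (fun w _ => stepsOf w) ?_ ?_ ?_ fun w hw => weight_eq_pathWeight _ _ hw
  · intro w hw
    obtain ⟨f, g, h⟩ := exists_copyPositions hw
    exact h.stepsOf_mem_ballot
  · intro w hw w' hw' e
    obtain ⟨f, g, h⟩ := exists_copyPositions hw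
    obtain ⟨f', g', h'⟩ := exists_copyPositions hw'
    -- The path determines all step indices, and these with σ determine the word.
    funext i
    obtain ⟨hi, e1⟩ := h.apply_eq i
    obtain ⟨hi', e2⟩ := h'.apply_eq i
    rw [e1, e2]
    simp only [e]
  · intro l hl
    obtain ⟨w, hw, e⟩ := exists_word σ hl
    exact ⟨w, hw, e⟩

end Words
end Nonnesting

theorem theorem2 (n : ℕ) (σ : Equiv.Perm (Fin n)) :
    Nonnesting.C σ = MvPolynomial.X 0 ^ Nonnesting.des (fun i => σ i) * Nonnesting.N n := by
  rw [Nonnesting.C_eq_sum_ballot, Nonnesting.sum_pathWeight _ _ _ (Nonnesting.letters_injective σ),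
    Nonnesting.des_perm, Nonnesting.N_eq_transfer]
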